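/- A polytope is the convex hull of a finite set of points in some $\mathbb{R}^d$; its facets are its inclusion-maximal proper nonempty faces. The extension complexity $\mathrm{xc}(P)$ of a polytope $P$ is the minimum number of facets of a polytope $Q$ (in a real space of any finite dimension) such that $P$ is the image of $Q$ under a linear map. For a finite simple graph $G$ with vertex set $\{1,\dots,n\}$ and $k\in\mathbb{N}$, let $\mathrm{STAB}_k(G)\subseteq\mathbb{R}^n$ be the convex hull of the characteristic vectors of the independent sets of $G$ of size exactly $k$, and let $\mathrm{STAB}^{\leqslant}_k(G)\subseteq\mathbb{R}^n$ be the convex hull of the characteristic vectors of the independent sets of $G$ of size at most $k$. **Theorem.** There is no function $f:\mathbb{N}\to\mathbb{R}$ (computable or not) such that $\mathrm{xc}(\mathrm{STAB}_k(G))\leqslant f(k)\cdot n^{\mathcal{O}(1)}$ for all $k\in\mathbb{N}$ and all graphs $G$ on $n\geqslant 1$ vertices; that is, there do not exist a function $f:\mathbb{N}\to\mathbb{R}$ and a constant $c\in\mathbb{R}$ such that $\mathrm{xc}(\mathrm{STAB}_k(G))\leqslant f(k)\cdot n^{c}$ for all $k\in\mathbb{N}$, all $n\geqslant 1$ and all $n$-vertex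 graphs $G$. The same holds with $\mathrm{STAB}^{\leqslant}_k(G)$ in place of $\mathrm{STAB}_k(G)$. -/

import Mathlib

namespace ExtensionComplexity

/-- A polytope in `ℝ^d`: the convex hull of a finite (possibly empty) set of points. -/
def IsPolytope {d : ℕ} (Q : Set (Fin d → ℝ)) : Prop :=
  ∃ S : Set (Fin d → ℝ), S.Finite ∧ Q = convexHull ℝ S

/-- A proper face of `Q`: a nonempty set of the form "all maximizers over `Q` of some linear
functional" which is different from `Q`. -/
def IsProperFace {d : ℕ} (Q F : Set (Fin d → ℝ)) : Prop :=
  F.Nonempty ∧ F ≠ Q ∧ IsExposed ℝ Q F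

/-- The facets of `Q`: its inclusion-maximal proper faces. -/
def facets {d : ℕ} (Q : Set (Fin d → ℝ)) : Set (Set (Fin d → ℝ)) :=
  {F | Maximal (IsProperFace Q) F}

/-- `Q` is an extension of `P`: it is a polytope, and `P` is the image of `Q` under some
linear map. -/
def IsExtension {d m : ℕ} (Q : Set (Fin d → ℝ)) (P : Set (Fin m → ℝ)) : Prop :=
  IsPolytope Q ∧ ∃ π : (Fin d → ℝ) →ₗ[ℝ] (Fin m → ℝ), π '' Q = P

/-- The extension complexity of `P`: the smallest number of facets of an extension of `P`
(in a space of any dimension). For a polytope `P` the minimum is attained, see `xc_spec`. -/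
noncomputable def xc {m : ℕ} (P : Set (Fin m → ℝ)) : ℕ :=
  sInf {s : ℕ | ∃ (d : ℕ) (Q : Set (Fin d → ℝ)), IsExtension Q P ∧ (facets Q).encard = s}

theorem IsPolytope.finite_facets {d : ℕ} {Q : Set (Fin d → ℝ)} (hQ : IsPolytope Q) :
    (facets Q).Finite := by
  obtain ⟨S, hS, rfl⟩ := hQ
  have hc : IsCompact (convexHull ℝ S) := hS.isCompact_convexHull (𝕜 := ℝ)
  have key : ∀ F ∈ facets (convexHull ℝ S),
      closure (convexHull ℝ (F.extremePoints ℝ)) = F := fun F hF =>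
    closure_convexHull_extremePoints (hF.prop.2.2.isCompact hc)
      (hF.prop.2.2.convex (convex_convexHull ℝ S))
  refine Set.Finite.of_finite_image (f := fun F => F.extremePoints ℝ)
    (hS.finite_subsets.subset ?_) ?_
  · rintro _ ⟨F, hF, rfl⟩
    exact (hF.prop.2.2.isExtreme.extremePoints_subset_extremePoints).trans
      extremePoints_convexHull_subset
  · intro F hF F' hF' h
    rw [← key F hF, ← key F' hF']
    exact congrArg (fun T => closure (convexHull ℝ T)) h

/-- The extension complexity of a polytope is attained by some extension. -/
theorem xc_spec {m : ℕ} {P : Set (Fin m → ℝ)} (hP : IsPolytope P) :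
    ∃ (d : ℕ) (Q : Set (Fin d → ℝ)), IsExtension Q P ∧ (facets Q).encard = xc P := by
  have hne : {s : ℕ | ∃ (d : ℕ) (Q : Set (Fin d → ℝ)),
      IsExtension Q P ∧ (facets Q).encard = s}.Nonempty :=
    ⟨(facets P).ncard, m, P, ⟨hP, LinearMap.id, by simp⟩,
      (hP.finite_facets.cast_ncard_eq).symm⟩
  exact Nat.sInf_mem hne

/-- The characteristic vector of a set of vertices. -/
noncomputable def charVec {n : ℕ} (S : Finset (Fin n)) : Fin n → ℝ :=
  fun v => if v ∈ S then 1 else 0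

/-- The convex hull of the characteristic vectors of the independent sets of `G` of size
exactly `k`. -/
noncomputable def stab {n : ℕ} (k : ℕ) (G : SimpleGraph (Fin n)) : Set (Fin n → ℝ) :=
  convexHull ℝ (charVec '' {S : Finset (Fin n) | G.IsIndepSet (S : Set (Fin n)) ∧ S.card = k})

/-- The convex hull of the characteristic vectors of the independent sets of `G` of size
at most `k`. -/
noncomputable def stabLE {n : ℕ} (k : ℕ) (G : SimpleGraph (Fin n)) : Set (Fin n → ℝ) :=
  convexHull ℝ (charVec '' {S : Finset (Fin n) | G.IsIndepSet (S : Set (Fin n)) ∧ S.card ≤ k})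

end ExtensionComplexity

/-! Split a ground set of `k * t` elements into `k` blocks of size `t`. The vertices of `G` are the
subsets of unions of two blocks, one copy for each of the `k ^ 2` ordered pairs of blocks, and
inconsistent vertices are adjacent. Thus `n ≤ k ^ 2 * 4 ^ t`, and independent sets of size `k ^ 2`
correspond to subsets `b` of the ground set (`exists_eq_restrictions`). Any two elements lie in a
common union, so quadratic functions of `b` become linear in the characteristic vector. For each
nonempty `a` this gives a valid inequality with slack `(1 - |a ∩ b|) ^ 2` at `b` (`sum_weight`,
`three_pow_le_xc`).

The facets of an extension cover the support of this slack matrix by rectangles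
(`IsExtension.exists_rectangle_cover`). A rectangle without pairs meeting in exactly one element
holds at most `2 ^ (k * t)` of the `3 ^ (k * t)` disjoint pairs (`card_disjoint_pairs_le`), so about
`(3 / 2) ^ (k * t)` facets are needed. For fixed large `k` and growing `t` this beats `f (k ^ 2) * n
^ c`. -/

namespace ExtensionComplexity

/-! ### Faces, facets and rectangle covers -/

/-- A proper face of a polytope and a point of the polytope outside this face are separated by
some facet. -/
theorem exists_facet_of_notMem {d : ℕ} {Q F : Set (Fin d → ℝ)} (hQ : IsPolytope Q)
    (hF : IsProperFace Q F) {y : Fin d → ℝ} (hy : y ∈ Q) (hyF : y ∉ F) :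
    ∃ G ∈ facets Q, F ⊆ G ∧ y ∉ G := by
  obtain ⟨S, hS, rfl⟩ := hQ
  -- Among the proper faces that contain `F` and miss `y`, take one missing the fewest points of
  -- `S`; it turns out to be a facet.
  obtain ⟨G, ⟨hG, hFG, hyG⟩, hmin⟩ :=
    (measure fun G : Set (Fin d → ℝ) => (S \ G).ncard).wf.has_min
      {G | IsProperFace (convexHull ℝ S) G ∧ F ⊆ G ∧ y ∉ G} ⟨F, hF, subset_rfl, hyF⟩
  refine ⟨G, ⟨hG, fun H hH hGH => ?_⟩, hFG, hyG⟩
  by_contra hHG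
  have hGssub : ¬ H ⊆ G := hHG
  obtain ⟨l, hl⟩ := hG.2.2 hG.1
  obtain ⟨h, hh⟩ := hH.2.2 hH.1
  obtain ⟨g, hg⟩ := hG.1
  have hgH : g ∈ H := hGH hg
  have memG : ∀ x ∈ convexHull ℝ S, x ∈ G ↔ l x = l g := by
    intro x hx
    have hg' := hg
    rw [hl] at hg' ⊢
    refine ⟨fun h' => le_antisymm (hg'.2 x hx) (h'.2 g hg'.1), fun h' => ⟨hx, fun z hz => ?_⟩⟩
    rw [h']
    exact hg'.2 z hz
  have memH : ∀ x ∈ convexHull ℝ S, x ∈ H ↔ h x = h g := by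
    intro x hx
    have hg' := hgH
    rw [hh] at hg' ⊢
    refine ⟨fun h' => le_antisymm (hg'.2 x hx) (h'.2 g hg'.1), fun h' => ⟨hx, fun z hz => ?_⟩⟩
    rw [h']
    exact hg'.2 z hz
  have lle : ∀ x ∈ convexHull ℝ S, l x ≤ l g := by
    rw [hl] at hg
    exact hg.2
  have hle : ∀ x ∈ convexHull ℝ S, h x ≤ h g := by
    rw [hh] at hgH
    exact hgH.2
  have hgQ : g ∈ convexHull ℝ S := hG.2.2.subset hg
  have hyH : y ∈ H := by
    by_contra hyH
    refine hmin H ⟨hH, hFG.trans hGH, hyH⟩ ?_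
    have hsub : S \ H ⊆ S \ G := Set.sdiff_subset_sdiff_right hGH
    refine Set.ncard_lt_ncard ⟨hsub, fun hsub' => hGssub ?_⟩ hS.sdiff
    have hc : IsCompact (convexHull ℝ S) := hS.isCompact_convexHull (𝕜 := ℝ)
    rw [← closure_convexHull_extremePoints (hH.2.2.isCompact hc)
      (hH.2.2.convex (convex_convexHull ℝ S))]
    refine closure_minimal (convexHull_min (fun z hz => ?_)
      (hG.2.2.convex (convex_convexHull ℝ S))) (hG.2.2.isCompact hc).isClosed
    have hzS : z ∈ S := extremePoints_convexHull_subset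
      (hH.2.2.isExtreme.extremePoints_subset_extremePoints hz)
    by_contra hzG
    exact (hsub' ⟨hzS, hzG⟩).2 hz.1
  have hne : (S \ H).Nonempty := by
    by_contra hemp
    rw [Set.not_nonempty_iff_eq_empty, Set.sdiff_eq_empty] at hemp
    exact hH.2.1 (hH.2.2.subset.antisymm
      (convexHull_min hemp (hH.2.2.convex (convex_convexHull ℝ S))))
  -- Tilt `l` by `h`: the minimal ratio `t` is the largest multiple of `h` that can be subtracted
  -- while `g` stays maximal. Then `v ∉ H` becomes a maximizer too, whereas `y` does not, because
  -- `h` is constant on `H`. The resulting face contradicts the minimality of `G`.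
  obtain ⟨v, ⟨hvS, hvH⟩, hv⟩ :=
    Set.exists_min_image (S \ H) (fun v => (l g - l v) / (h g - h v)) hS.sdiff hne
  have hpos : ∀ u ∈ S \ H, 0 < h g - h u := fun u hu =>
    sub_pos.2 (lt_of_le_of_ne (hle u (subset_convexHull ℝ S hu.1))
      fun e => hu.2 ((memH u (subset_convexHull ℝ S hu.1)).2 e))
  set t : ℝ := (l g - l v) / (h g - h v) with ht
  set N : StrongDual ℝ (Fin d → ℝ) := l - t • h with hN
  have hNS : ∀ u ∈ S, N u ≤ N g := by
    intro u hu
    have huQ := subset_convexHull ℝ S hu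
    simp only [hN, sub_apply, smul_apply, smul_eq_mul]
    by_cases huH : u ∈ H
    · rw [(memH u huQ).1 huH]
      linarith [lle u huQ]
    · have h1 := hv u ⟨hu, huH⟩
      rw [le_div_iff₀ (hpos u ⟨hu, huH⟩)] at h1
      linarith [mul_sub t (h g) (h u)]
  have hNQ : ∀ x ∈ convexHull ℝ S, N x ≤ N g := fun x hx =>
    convexHull_min (t := {x | N x ≤ N g}) hNS (convex_halfSpace_le N.toLinearMap.isLinear _) hx
  have hvN : N v = N g := by
    have h1 := hpos v ⟨hvS, hvH⟩
    simp only [hN, sub_apply, smul_apply, smul_eq_mul]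
    have : t * (h g - h v) = l g - l v := div_mul_cancel₀ _ h1.ne'
    linarith [mul_sub t (h g) (h v)]
  let G' : Set (Fin d → ℝ) := {x ∈ convexHull ℝ S | ∀ z ∈ convexHull ℝ S, N z ≤ N x}
  have hvG' : v ∈ G' := ⟨subset_convexHull ℝ S hvS, fun z hz => hvN ▸ hNQ z hz⟩
  have hGG' : G ⊆ G' := by
    intro x hx
    have hxQ := hG.2.2.subset hx
    refine ⟨hxQ, fun z hz => (hNQ z hz).trans (le_of_eq ?_)⟩
    simp only [hN, sub_apply, smul_apply, smul_eq_mul]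
    rw [(memG x hxQ).1 hx, (memH x hxQ).1 (hGH hx)]
  have hyG' : y ∉ G' := by
    intro h'
    have h1 := h'.2 g hgQ
    simp only [hN, sub_apply, smul_apply, smul_eq_mul,
      (memH y hy).1 hyH] at h1
    exact hyG ((memG y hy).2 (le_antisymm (lle y hy) (by linarith)))
  refine hmin G' ⟨⟨⟨v, hvG'⟩, fun e => hyG' (e ▸ hy), fun _ => ⟨N, rfl⟩⟩, hFG.trans hGG', hyG'⟩ ?_
  refine Set.ncard_lt_ncard ⟨Set.sdiff_subset_sdiff_right hGG', fun hsub => ?_⟩ hS.sdiff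
  exact (hsub ⟨hvS, fun hvG => hvH (hGH hvG)⟩).2 hvG'

/-- An extension of `P` yields, for linear inequalities `ℓ a ≤ δ a` that are valid and tight on `P`
and points `x b` of `P`, a cover of the support of the slack matrix by rectangles, one for each
facet of the extension. -/
theorem IsExtension.exists_rectangle_cover {d m : ℕ} {Q : Set (Fin d → ℝ)} {P : Set (Fin m → ℝ)}
    (hQP : IsExtension Q P) {ι κ : Type*} (ℓ : ι → (Fin m → ℝ) →ₗ[ℝ] ℝ) (δ : ι → ℝ)
    (x : κ → Fin m → ℝ) (hx : ∀ b, x b ∈ P) (hle : ∀ a, ∀ z ∈ P, ℓ a z ≤ δ a)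
    (htight : ∀ a, ∃ z ∈ P, ℓ a z = δ a) :
    ∃ (A : Set (Fin d → ℝ) → Set ι) (B : Set (Fin d → ℝ) → Set κ),
      (∀ a b, ℓ a (x b) ≠ δ a → ∃ F ∈ facets Q, a ∈ A F ∧ b ∈ B F) ∧
      ∀ F, ∀ a ∈ A F, ∀ b ∈ B F, ℓ a (x b) ≠ δ a := by
  obtain ⟨hQ, π, rfl⟩ := hQP
  choose y hyQ hy using hx
  let face : ι → Set (Fin d → ℝ) := fun a => {q ∈ Q | ∀ z ∈ Q, ℓ a (π z) ≤ ℓ a (π q)}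
  have hface : ∀ a, ∀ q ∈ Q, q ∈ face a ↔ ℓ a (π q) = δ a := by
    intro a q hq
    constructor
    · intro h
      obtain ⟨_, ⟨z, hz, rfl⟩, hza⟩ := htight a
      exact le_antisymm (hle a _ ⟨q, hq, rfl⟩) (hza ▸ h.2 z hz)
    · intro h
      exact ⟨hq, fun z hz => h ▸ hle a _ ⟨z, hz, rfl⟩⟩
  refine ⟨fun F => {a | face a ⊆ F}, fun F => {b | y b ∉ F}, fun a b hab => ?_,
    fun F a ha b hb hab => hb (ha ((hface a _ (hyQ b)).2 (by rw [hy, hab])))⟩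
  have hyb : y b ∉ face a := fun h => hab (by rw [← hy b]; exact (hface a _ (hyQ b)).1 h)
  refine exists_facet_of_notMem hQ ⟨?_, fun e : face a = Q => hyb (e.symm ▸ hyQ b), fun _ =>
    ⟨LinearMap.toContinuousLinearMap (ℓ a ∘ₗ π), rfl⟩⟩ (hyQ b) hyb
  obtain ⟨_, ⟨z, hz, rfl⟩, hza⟩ := htight a
  exact ⟨z, (hface a z hz).2 hza⟩

/-! ### Unique disjointness -/

/-- A rectangle of pairs of subsets of `s`, none of which meet in exactly one element, contains at
most `2 ^ #s` disjoint pairs. -/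
theorem card_disjoint_pairs_le {α : Type*} [DecidableEq α] (s : Finset α) :
    ∀ A B : Finset (Finset α), (∀ a ∈ A, a ⊆ s) → (∀ b ∈ B, b ⊆ s) →
      (∀ a ∈ A, ∀ b ∈ B, (a ∩ b).card ≠ 1) →
      ((A ×ˢ B).filter fun p => Disjoint p.1 p.2).card ≤ 2 ^ s.card := by
  induction s using Finset.induction_on with
  | empty =>
    intro A B hA hB _
    refine Finset.card_le_one.2 fun p hp q hq => ?_
    simp only [Finset.mem_filter, Finset.mem_product] at hp hq
    exact Prod.ext
      ((Finset.subset_empty.1 (hA _ hp.1.1)).trans (Finset.subset_empty.1 (hA _ hq.1.1)).symm)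
      ((Finset.subset_empty.1 (hB _ hp.1.2)).trans (Finset.subset_empty.1 (hB _ hq.1.2)).symm)
  | insert x s hxs ih =>
    intro A B hA hB hAB
    have herase : ∀ a : Finset α, a ⊆ insert x s → a.erase x ⊆ s := fun a ha =>
      Finset.subset_insert_iff.1 ha
    have hnot : ∀ a : Finset α, a ⊆ insert x s → x ∉ a → a ⊆ s := fun a ha hx =>
      (Finset.subset_insert_iff_of_notMem hx).1 ha
    have h1 := ih (A.image fun a => a.erase x) (B.filter fun b => x ∉ b)
      (by simpa using fun a ha => herase a (hA a ha))
      (by simpa using fun b hb => hnot b (hB b hb))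
      (by
        simp only [Finset.mem_image, Finset.mem_filter, forall_exists_index, and_imp]
        rintro _ a ha rfl b hb hxb
        rw [Finset.erase_inter, Finset.erase_eq_of_notMem (by simp [hxb])]
        exact hAB a ha b hb)
    have h2 := ih (A.filter fun a => x ∉ a) (B.image fun b => b.erase x)
      (by simpa using fun a ha => hnot a (hA a ha))
      (by simpa using fun b hb => herase b (hB b hb))
      (by
        simp only [Finset.mem_image, Finset.mem_filter, forall_exists_index, and_imp]
        rintro a ha hxa _ b hb rfl
        rw [Finset.inter_erase, Finset.erase_eq_of_notMem (by simp [hxa])]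
        exact hAB a ha b hb)
    set D := (A ×ˢ B).filter fun p => Disjoint p.1 p.2 with hD
    -- Delete `x` from `a` in the first class and from `b` in the second. The classes are chosen to
    -- make both maps injective: in the second, a collision would put `insert x a` in `A` and some
    -- `b ∋ x` disjoint from `a` in `B`, and these meet only in `x`.
    have hsplit := Finset.card_filter_add_card_filter_not (s := D)
      (fun p => x ∉ p.2 ∧ (x ∈ p.1 ∨ insert x p.1 ∉ A))
    rw [Finset.card_insert_of_notMem hxs, pow_succ, mul_two, ← hsplit]
    refine add_le_add (le_trans ?_ h1) (le_trans ?_ h2)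
    · refine Finset.card_le_card_of_injOn (fun p => (p.1.erase x, p.2)) ?_ ?_
      · rintro ⟨a, b⟩ hp
        simp only [hD, Finset.coe_filter, Finset.mem_filter, Finset.mem_product,
          Set.mem_ofPred_eq, Finset.mem_image] at hp ⊢
        exact ⟨⟨⟨a, hp.1.1.1, rfl⟩, hp.1.1.2, hp.2.1⟩,
          hp.1.2.mono_left (Finset.erase_subset x a)⟩
      · rintro ⟨a, b⟩ hp ⟨a', b'⟩ hq he
        simp only [hD, Finset.coe_filter, Finset.mem_filter, Finset.mem_product,
          Set.mem_ofPred_eq, Prod.mk.injEq] at hp hq he ⊢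
        refine ⟨?_, he.2⟩
        have he1 := he.1
        by_cases ha : x ∈ a <;> by_cases ha' : x ∈ a'
        · rw [← Finset.insert_erase ha, he1, Finset.insert_erase ha']
        · rw [Finset.erase_eq_of_notMem ha'] at he1
          rw [← he1, Finset.insert_erase ha] at hq
          simp_all
        · rw [Finset.erase_eq_of_notMem ha] at he1
          rw [he1, Finset.insert_erase ha'] at hp
          simp_all
        · rwa [Finset.erase_eq_of_notMem ha, Finset.erase_eq_of_notMem ha'] at he1
    · have hxp : ∀ p ∈ D, ¬(x ∉ p.2 ∧ (x ∈ p.1 ∨ insert x p.1 ∉ A)) →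
          x ∉ p.1 ∧ (x ∉ p.2 → insert x p.1 ∈ A) := by
        rintro ⟨a, b⟩ hp hq
        have hdis := (Finset.mem_filter.1 hp).2
        by_cases hb : x ∈ b
        · exact ⟨fun ha => Finset.disjoint_left.1 hdis ha hb, fun h => absurd hb h⟩
        · simp only [not_and, not_or, not_not] at hq
          exact ⟨(hq hb).1, fun _ => (hq hb).2⟩
      have key : ∀ a b b' : Finset α, (a, b) ∈ D → (a, b') ∈ D → x ∉ a → insert x a ∈ A →
          x ∈ b → False := by
        intro a b b' hp _ ha haA hb
        simp only [hD, Finset.mem_filter, Finset.mem_product] at hp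
        refine hAB _ haA b hp.1.2 ?_
        rw [Finset.insert_inter_of_mem hb, Finset.disjoint_iff_inter_eq_empty.1 hp.2]
        simp
      refine Finset.card_le_card_of_injOn (fun p => (p.1, p.2.erase x)) ?_ ?_
      · rintro ⟨a, b⟩ hp
        have hp := Finset.mem_filter.1 hp
        have hx := hxp _ hp.1 hp.2
        simp only [hD, Finset.coe_filter, Finset.mem_filter, Finset.mem_product,
          Set.mem_ofPred_eq, Finset.mem_image] at hp ⊢
        exact ⟨⟨⟨hp.1.1.1, hx.1⟩, b, hp.1.1.2, rfl⟩,
          hp.1.2.mono_right (Finset.erase_subset x b)⟩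
      · rintro ⟨a, b⟩ hp ⟨a', b'⟩ hq he
        have hp := Finset.mem_filter.1 hp
        have hq := Finset.mem_filter.1 hq
        obtain ⟨ha, hins⟩ := hxp _ hp.1 hp.2
        obtain ⟨ha', hins'⟩ := hxp _ hq.1 hq.2
        simp only [Prod.mk.injEq] at he ⊢
        obtain ⟨rfl, he1⟩ := he
        refine ⟨rfl, ?_⟩
        by_cases hb : x ∈ b <;> by_cases hb' : x ∈ b'
        · rw [← Finset.insert_erase hb, he1, Finset.insert_erase hb']
        · exact (key a b b' hp.1 hq.1 ha (hins' hb') hb).elim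
        · exact (key a b' b hq.1 hp.1 ha (hins hb) hb').elim
        · rwa [Finset.erase_eq_of_notMem hb, Finset.erase_eq_of_notMem hb'] at he1

/-- A set of `N` elements has at least `3 ^ N` ordered pairs of disjoint subsets. -/
theorem three_pow_le_card_disjoint_pairs (X : Type*) [Fintype X] [DecidableEq X] :
    3 ^ Fintype.card X ≤
      ((Finset.univ : Finset (Finset X × Finset X)).filter fun p => Disjoint p.1 p.2).card := by
  have h : (Finset.univ : Finset (X → Fin 3)).card = 3 ^ Fintype.card X := by simp
  rw [← h]
  refine Finset.card_le_card_of_injOn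
    (fun f => (Finset.univ.filter fun x => f x = 0, Finset.univ.filter fun x => f x = 1)) ?_ ?_
  · intro f _
    simp only [Finset.coe_filter, Finset.mem_univ, true_and, Set.mem_ofPred_eq]
    refine Finset.disjoint_filter.2 fun x _ h0 h1 => ?_
    rw [h0] at h1
    exact absurd h1 (by decide)
  · intro f _ g _ hfg
    simp only [Prod.mk.injEq, Finset.ext_iff, Finset.mem_filter, Finset.mem_univ, true_and] at hfg
    funext x
    have h0 := hfg.1 x
    have h1 := hfg.2 x
    generalize f x = i at *
    generalize g x = j at *
    revert i j
    decide

/-- If every pair of a nonempty set and a set disjoint from it lies in one of finitely many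
rectangles free of pairs meeting in exactly one element, then there are many rectangles. -/
theorem three_pow_le_of_rectangle_cover {X ι : Type*} [Fintype X] [DecidableEq X]
    (T : Finset ι) (A B : ι → Set (Finset X))
    (hcover : ∀ a b : Finset X, a.Nonempty → Disjoint a b → ∃ F ∈ T, a ∈ A F ∧ b ∈ B F)
    (hfree : ∀ F ∈ T, ∀ a ∈ A F, ∀ b ∈ B F, (a ∩ b).card ≠ 1) :
    3 ^ Fintype.card X ≤ (T.card + 1) * 2 ^ Fintype.card X := by
  classical
  let D : Finset (Finset X) → Finset (Finset X) → Finset (Finset X × Finset X) := fun A B =>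
    (A ×ˢ B).filter fun p => Disjoint p.1 p.2
  let A' : ι → Finset (Finset X) := fun F => Finset.univ.filter (· ∈ A F)
  let B' : ι → Finset (Finset X) := fun F => Finset.univ.filter (· ∈ B F)
  -- The pairs with `a = ∅` form one extra rectangle, hence the `+ 1`.
  have hsub : ((Finset.univ : Finset (Finset X × Finset X)).filter fun p => Disjoint p.1 p.2) ⊆
      T.biUnion (fun F => D (A' F) (B' F)) ∪ D {∅} Finset.univ := by
    rintro ⟨a, b⟩ hp
    have hdis := (Finset.mem_filter.1 hp).2
    rcases a.eq_empty_or_nonempty with rfl | ha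
    · simp [D]
    · obtain ⟨F, hF, haF, hbF⟩ := hcover a b ha hdis
      refine Finset.mem_union_left _ (Finset.mem_biUnion.2 ⟨F, hF, ?_⟩)
      simpa [D, A', B'] using ⟨⟨haF, hbF⟩, hdis⟩
  calc 3 ^ Fintype.card X ≤ _ := three_pow_le_card_disjoint_pairs X
    _ ≤ _ := Finset.card_le_card hsub
    _ ≤ _ := Finset.card_union_le _ _
    _ ≤ T.card * 2 ^ Fintype.card X + 2 ^ Fintype.card X := by
      refine add_le_add (Finset.card_biUnion_le_card_mul _ _ _ fun F hF => ?_) ?_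
      · exact card_disjoint_pairs_le Finset.univ _ _ (fun _ _ => Finset.subset_univ _)
          (fun _ _ => Finset.subset_univ _) fun a ha b hb =>
            hfree F hF a (Finset.mem_filter.1 ha).2 b (Finset.mem_filter.1 hb).2
      · exact card_disjoint_pairs_le Finset.univ _ _ (fun _ _ => Finset.subset_univ _)
          (fun _ _ => Finset.subset_univ _) (by simp)
    _ = _ := by ring

/-! ### The consistency graph -/

section Consistency

variable {X E : Type*} [DecidableEq X]

/-- The graph on vertices labelled by partial assignments `(e, c)`, meaning that exactly the
elements of `c` among those of `scope e` are selected; inconsistent assignments are adjacent. -/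
def consistencyGraph {n : ℕ} (scope : E → Finset X) (label : Fin n → E × Finset X) :
    SimpleGraph (Fin n) where
  Adj u v := u ≠ v ∧
    (label u).2 ∩ scope (label v).1 ≠ (label v).2 ∩ scope (label u).1
  symm := ⟨fun _ _ h => ⟨h.1.symm, h.2.symm⟩⟩
  loopless := ⟨fun _ h => h.1 rfl⟩

/-- The vertices consistent with the global assignment selecting `b`. -/
def restrictions [DecidableEq E] {n : ℕ} (scope : E → Finset X) (label : Fin n → E × Finset X)
    (b : Finset X) : Finset (Fin n) :=
  Finset.univ.filter fun v => (label v).2 = b ∩ scope (label v).1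

/-- The weight of the partial assignment `(e, c)` such that the weights of all restrictions of `b`
sum up to `2 |a ∩ b| - |a ∩ b| ^ 2`. -/
def weight [DecidableEq E] (pick : X × X → E) (a : Finset X) (v : E × Finset X) : ℝ :=
  2 * (((a ∩ v.2).filter fun x => pick (x, x) = v.1).card : ℝ) -
    ((((a ∩ v.2) ×ˢ (a ∩ v.2)).filter fun p => pick p = v.1).card : ℝ)

variable {n : ℕ} {scope : E → Finset X} {label : Fin n → E × Finset X}

/-- Distinct assignments of the same scope are inconsistent. Hence independent sets have at most
`|E|` vertices. -/
theorem injOn_of_isIndepSet (hinj : Function.Injective label)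
    (hscope : ∀ v, (label v).2 ⊆ scope (label v).1) {S : Finset (Fin n)}
    (hS : (consistencyGraph scope label).IsIndepSet (S : Set (Fin n))) :
    Set.InjOn (fun v => (label v).1) S := by
  intro u hu v hv huv
  by_contra hne
  refine hS hu hv hne ⟨hne, fun h => hne (hinj (Prod.ext huv ?_))⟩
  have huv : (label u).1 = (label v).1 := huv
  have hu' := hscope u
  rw [huv] at h hu'
  rwa [Finset.inter_eq_left.2 hu', Finset.inter_eq_left.2 (hscope v)] at h

variable [DecidableEq E]

/-- Numbering of all partial assignments. -/
theorem exists_label {X E : Type*} [Fintype E] (scope : E → Finset X) :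
    ∃ (n : ℕ) (label : Fin n → E × Finset X), n = ∑ e, 2 ^ (scope e).card ∧
      Function.Injective label ∧ (∀ v, (label v).2 ⊆ scope (label v).1) ∧
      ∀ e, ∀ c ⊆ scope e, ∃ v, label v = (e, c) := by
  let φ := (Fintype.equivFin (Σ e, (scope e).powerset)).symm
  refine ⟨_, fun v => ((φ v).1, (φ v).2), ?_, ?_, fun v => Finset.mem_powerset.1 (φ v).2.2,
    fun e c hc => ⟨φ.symm ⟨e, c, Finset.mem_powerset.2 hc⟩, ?_⟩⟩
  · simp only [Fintype.card_sigma, Fintype.card_coe, Finset.card_powerset]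
  · intro u v huv
    refine φ.injective ?_
    simp only [Prod.mk.injEq] at huv
    revert huv
    generalize φ u = p
    generalize φ v = q
    rintro ⟨h1, h2⟩
    obtain ⟨e, c⟩ := p
    obtain ⟨e', c'⟩ := q
    obtain rfl : e = e' := h1
    obtain rfl : c = c' := Subtype.ext h2
    rfl
  · dsimp only
    rw [φ.apply_symm_apply]

theorem isIndepSet_restrictions (b : Finset X) :
    (consistencyGraph scope label).IsIndepSet (restrictions scope label b : Set (Fin n)) := by
  intro u hu v hv _ hadj
  simp only [restrictions, Finset.coe_filter, Finset.mem_univ, true_and, Set.mem_ofPred_eq] at hu hv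
  refine hadj.2 ?_
  rw [hu, hv, Finset.inter_right_comm]

/-- Maximum independent sets of the consistency graph come from global assignments. -/
theorem exists_eq_restrictions [Fintype E] (hinj : Function.Injective label)
    (hscope : ∀ v, (label v).2 ⊆ scope (label v).1) {S : Finset (Fin n)}
    (hS : (consistencyGraph scope label).IsIndepSet (S : Set (Fin n)))
    (hcard : S.card = Fintype.card E) : ∃ b, S = restrictions scope label b := by
  -- By cardinality, every constraint is represented in `S`; the union of the chosen sets is then
  -- the global assignment.
  have himg : S.image (fun v => (label v).1) = Finset.univ := by
    rw [← Finset.card_eq_iff_eq_univ, Finset.card_image_of_injOn (injOn_of_isIndepSet hinj hscope hS),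
      hcard]
  have hmem : ∀ v ∈ S, (label v).2 = S.biUnion (fun u => (label u).2) ∩ scope (label v).1 := by
    intro v hv
    ext x
    simp only [Finset.mem_inter, Finset.mem_biUnion]
    refine ⟨fun hx => ⟨⟨v, hv, hx⟩, hscope v hx⟩, ?_⟩
    rintro ⟨⟨u, hu, hxu⟩, hxv⟩
    by_cases huv : u = v
    · exact huv ▸ hxu
    by_contra hx
    refine hS hu hv huv ⟨huv, fun h => hx ?_⟩
    have : x ∈ (label u).2 ∩ scope (label v).1 := Finset.mem_inter.2 ⟨hxu, hxv⟩
    rw [h] at this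
    exact (Finset.mem_inter.1 this).1
  refine ⟨S.biUnion fun u => (label u).2, Finset.Subset.antisymm (fun v hv => ?_) fun v hv => ?_⟩
  · simpa [restrictions] using hmem v hv
  · have hv' := (Finset.mem_filter.1 hv).2
    obtain ⟨u, hu, huv⟩ := Finset.mem_image.1 (himg ▸ Finset.mem_univ (label v).1)
    have h2 : (label u).2 = (label v).2 := by rw [hmem u hu, hv', huv]
    rwa [← hinj (Prod.ext huv h2)]

/-- Each constraint contributes exactly one vertex consistent with a global assignment. -/
theorem sum_restrictions [Fintype E] (hinj : Function.Injective label)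
    (hrange : ∀ e, ∀ c ⊆ scope e, ∃ v, label v = (e, c)) (b : Finset X)
    (w : E × Finset X → ℝ) :
    ∑ v ∈ restrictions scope label b, w (label v) = ∑ e, w (e, b ∩ scope e) := by
  refine Finset.sum_bij (fun v _ => (label v).1) (fun _ _ => Finset.mem_univ _) ?_ ?_ ?_
  · intro u hu v hv huv
    have hu := (Finset.mem_filter.1 hu).2
    have hv := (Finset.mem_filter.1 hv).2
    exact hinj (Prod.ext huv (by rw [hu, hv, huv]))
  · intro e _
    obtain ⟨v, hv⟩ := hrange e (b ∩ scope e) Finset.inter_subset_right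
    exact ⟨v, Finset.mem_filter.2 ⟨Finset.mem_univ _, by rw [hv]⟩, by rw [hv]⟩
  · intro v hv
    rw [← (Finset.mem_filter.1 hv).2]

theorem card_restrictions [Fintype E] (hinj : Function.Injective label)
    (hrange : ∀ e, ∀ c ⊆ scope e, ∃ v, label v = (e, c)) (b : Finset X) :
    (restrictions scope label b).card = Fintype.card E := by
  have h := sum_restrictions hinj hrange b fun _ => 1
  simp only [Finset.sum_const, nsmul_eq_mul, mul_one, Finset.card_univ] at h
  exact_mod_cast h

/-- Each element and each pair of elements of `a ∩ b` is counted only at the constraint picked for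
it, whose scope contains it; finally `2m - m ^ 2 = 1 - (1 - m) ^ 2`. -/
theorem sum_weight [Fintype E] {pick : X × X → E}
    (hpick : ∀ p, p.1 ∈ scope (pick p) ∧ p.2 ∈ scope (pick p)) (a b : Finset X) :
    ∑ e, weight pick a (e, b ∩ scope e) = 1 - (1 - ((a ∩ b).card : ℝ)) ^ 2 := by
  have h1 : ∀ e, (a ∩ (b ∩ scope e)).filter (fun x => pick (x, x) = e) =
      (a ∩ b).filter fun x => pick (x, x) = e := by
    intro e
    ext x
    simp only [Finset.mem_filter, Finset.mem_inter]
    refine ⟨fun h => ⟨⟨h.1.1, h.1.2.1⟩, h.2⟩, fun h => ⟨⟨h.1.1, h.1.2, ?_⟩, h.2⟩⟩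
    exact h.2 ▸ (hpick (x, x)).1
  have h2 : ∀ e, ((a ∩ (b ∩ scope e)) ×ˢ (a ∩ (b ∩ scope e))).filter (fun p => pick p = e) =
      ((a ∩ b) ×ˢ (a ∩ b)).filter fun p => pick p = e := by
    intro e
    ext p
    simp only [Finset.mem_filter, Finset.mem_inter, Finset.mem_product]
    refine ⟨fun h => ⟨⟨⟨h.1.1.1, h.1.1.2.1⟩, ⟨h.1.2.1, h.1.2.2.1⟩⟩, h.2⟩, fun h =>
      ⟨⟨⟨h.1.1.1, h.1.1.2, ?_⟩, ⟨h.1.2.1, h.1.2.2, ?_⟩⟩, h.2⟩⟩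
    · exact h.2 ▸ (hpick p).1
    · exact h.2 ▸ (hpick p).2
  have h3 := Finset.card_eq_sum_card_fiberwise (s := a ∩ b) (t := Finset.univ)
    (f := fun x => pick (x, x)) fun _ _ => Finset.mem_coe.2 (Finset.mem_univ _)
  have h4 := Finset.card_eq_sum_card_fiberwise (s := (a ∩ b) ×ˢ (a ∩ b)) (t := Finset.univ)
    (f := pick) fun _ _ => Finset.mem_coe.2 (Finset.mem_univ _)
  simp only [weight, h1, h2, Finset.sum_sub_distrib, ← Finset.mul_sum]
  rw [← Nat.cast_sum, ← Nat.cast_sum, ← h3, ← h4, Finset.card_product]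
  push_cast
  ring

end Consistency

/-- The linear functional summing up the coordinates with given coefficients. -/
noncomputable def coeffFunctional {n : ℕ} (w : Fin n → ℝ) : (Fin n → ℝ) →ₗ[ℝ] ℝ :=
  Fintype.linearCombination ℝ w

theorem coeffFunctional_charVec {n : ℕ} (w : Fin n → ℝ) (S : Finset (Fin n)) :
    coeffFunctional w (charVec S) = ∑ v ∈ S, w v := by
  simp [coeffFunctional, Fintype.linearCombination_apply, charVec, Finset.sum_ite_mem]

theorem isPolytope_convexHull_charVec {n : ℕ} (𝒮 : Set (Finset (Fin n))) :
    IsPolytope (convexHull ℝ (charVec '' 𝒮)) :=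
  ⟨_, 𝒮.toFinite.image _, rfl⟩

/-- Exponential lower bound on the extension complexity of polytopes spanned by independent sets of
a consistency graph, including all the maximum ones. -/
theorem three_pow_le_xc {X E : Type*} [Fintype X] [DecidableEq X] [Fintype E] [DecidableEq E]
    {n : ℕ} {scope : E → Finset X} {label : Fin n → E × Finset X} {pick : X × X → E}
    (hinj : Function.Injective label) (hscope : ∀ v, (label v).2 ⊆ scope (label v).1)
    (hrange : ∀ e, ∀ c ⊆ scope e, ∃ v, label v = (e, c))
    (hpick : ∀ p, p.1 ∈ scope (pick p) ∧ p.2 ∈ scope (pick p))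
    (𝒮 : Set (Finset (Fin n)))
    (hind : ∀ S ∈ 𝒮, (consistencyGraph scope label).IsIndepSet (S : Set (Fin n)))
    (hmem : ∀ b, restrictions scope label b ∈ 𝒮) :
    3 ^ Fintype.card X ≤
      (xc (convexHull ℝ (charVec '' 𝒮)) + 1) * 2 ^ Fintype.card X := by
  classical
  obtain ⟨d, Q, hQ, hxc⟩ := xc_spec (isPolytope_convexHull_charVec 𝒮)
  set K : ℝ := (Fintype.card E : ℝ) with hK
  -- `M a` bounds every partial sum of weights. Adding it to each coefficient makes the inequality
  -- hold for non-maximum sets, which forgo at least one `M a`. Nonempty `a` ensures tightness,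
  -- attained at a singleton `b ⊆ a`.
  let M : Finset X → ℝ := fun a => ∑ v, |weight pick a (label v)|
  let ℓ : {a : Finset X // a.Nonempty} → (Fin n → ℝ) →ₗ[ℝ] ℝ := fun a =>
    coeffFunctional fun v => weight pick a (label v) + M a
  let δ : {a : Finset X // a.Nonempty} → ℝ := fun a => 1 + M a * K
  have hval : ∀ a b, ℓ a (charVec (restrictions scope label b)) =
      δ a - (1 - ((a.1 ∩ b).card : ℝ)) ^ 2 := by
    intro a b
    simp only [ℓ, δ, coeffFunctional_charVec]
    rw [sum_restrictions hinj hrange b fun v => weight pick a v + M a, Finset.sum_add_distrib,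
      sum_weight hpick]
    simp only [Finset.sum_const, nsmul_eq_mul, Finset.card_univ, ← hK]
    ring
  have hle : ∀ a, ∀ z ∈ convexHull ℝ (charVec '' 𝒮), ℓ a z ≤ δ a := by
    intro a z hz
    refine convexHull_min (t := {z | ℓ a z ≤ δ a}) ?_ (convex_halfSpace_le (ℓ a).isLinear _) hz
    rintro _ ⟨S, hS, rfl⟩
    have hM : 0 ≤ M a := Finset.sum_nonneg fun _ _ => abs_nonneg _
    have hcard : S.card ≤ Fintype.card E := by
      rw [← Finset.card_image_of_injOn (injOn_of_isIndepSet hinj hscope (hind S hS))]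
      exact Finset.card_le_univ _
    rcases hcard.eq_or_lt with h | h
    · obtain ⟨b, rfl⟩ := exists_eq_restrictions hinj hscope (hind S hS) h
      change ℓ a _ ≤ _
      rw [hval]
      linarith [sq_nonneg (1 - ((a.1 ∩ b).card : ℝ))]
    · have h1 : ∑ v ∈ S, weight pick a (label v) ≤ M a :=
        (Finset.sum_le_sum fun v _ => le_abs_self _).trans
          (Finset.sum_le_univ_sum_of_nonneg fun _ => abs_nonneg _)
      have h2 : (S.card : ℝ) + 1 ≤ K := by
        rw [hK]
        exact_mod_cast h
      simp only [Set.mem_ofPred_eq, ℓ, δ, coeffFunctional_charVec, Finset.sum_add_distrib,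
        Finset.sum_const, nsmul_eq_mul]
      nlinarith [mul_le_mul_of_nonneg_left h2 hM]
  have hpt : ∀ b, charVec (restrictions scope label b) ∈ convexHull ℝ (charVec '' 𝒮) := fun b =>
    subset_convexHull ℝ _ ⟨_, hmem b, rfl⟩
  have hne : ∀ (a : {a : Finset X // a.Nonempty}) (b : Finset X),
      ℓ a (charVec (restrictions scope label b)) ≠ δ a ↔ (a.1 ∩ b).card ≠ 1 := by
    intro a b
    rw [hval, not_iff_not, sub_eq_self, sq_eq_zero_iff, sub_eq_zero, eq_comm]
    exact_mod_cast Iff.rfl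
  obtain ⟨A, B, hcover, hfree⟩ := hQ.exists_rectangle_cover ℓ δ
    (fun b => charVec (restrictions scope label b)) hpt hle fun a => by
      obtain ⟨x, hx⟩ := a.2
      refine ⟨_, hpt {x}, ?_⟩
      rw [hval, Finset.inter_singleton_of_mem hx]
      simp
  have hfin : (facets Q).Finite := hQ.1.finite_facets
  have hT : hfin.toFinset.card = xc (convexHull ℝ (charVec '' 𝒮)) := by
    rw [hfin.encard_eq_coe_toFinset_card] at hxc
    exact_mod_cast hxc
  rw [← hT]
  refine three_pow_le_of_rectangle_cover hfin.toFinset (fun F => Subtype.val '' A F) B ?_ ?_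
  · intro a b ha hab
    obtain ⟨F, hF, haF, hbF⟩ := hcover ⟨a, ha⟩ b
      ((hne _ _).2 (by simp [Finset.disjoint_iff_inter_eq_empty.1 hab]))
    exact ⟨F, hfin.mem_toFinset.2 hF, ⟨_, haF, rfl⟩, hbF⟩
  · rintro F _ _ ⟨a, ha, rfl⟩ b hb
    exact (hne a b).1 (hfree F a ha b hb)

/-! ### The lower bound for stable set polytopes -/

/-- Graphs on at most `k ^ 2 * 4 ^ t` vertices with stable set polytopes of extension complexity
exponential in `k * t`. -/
theorem exists_graph_three_pow_le_xc (k t : ℕ) (hk : 1 ≤ k) :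
    ∃ n : ℕ, 1 ≤ n ∧ n ≤ k ^ 2 * 4 ^ t ∧ ∃ G : SimpleGraph (Fin n),
      3 ^ (k * t) ≤ (xc (stab (k ^ 2) G) + 1) * 2 ^ (k * t) ∧
      3 ^ (k * t) ≤ (xc (stabLE (k ^ 2) G) + 1) * 2 ^ (k * t) := by
  obtain ⟨scope, pick, hsc, hpick⟩ : ∃ (scope : Fin k × Fin k → Finset (Fin k × Fin t))
      (pick : (Fin k × Fin t) × (Fin k × Fin t) → Fin k × Fin k),
      (∀ e, (scope e).card ≤ 2 * t) ∧ ∀ p, p.1 ∈ scope (pick p) ∧ p.2 ∈ scope (pick p) := by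
    refine ⟨fun e => {e.1, e.2} ×ˢ Finset.univ, fun p => (p.1.1, p.2.1), fun e => ?_,
      fun p => by simp⟩
    rw [Finset.card_product, Finset.card_univ, Fintype.card_fin]
    exact Nat.mul_le_mul_right t Finset.card_le_two
  obtain ⟨n, label, hn0, hinj, hscope, hrange⟩ := exists_label scope
  have hE : Fintype.card (Fin k × Fin k) = k ^ 2 := by simp [sq]
  have hX : Fintype.card (Fin k × Fin t) = k * t := by simp
  have hn : n ≤ k ^ 2 * 4 ^ t := by
    rw [hn0, ← hE, show (4 : ℕ) ^ t = 2 ^ (2 * t) by rw [pow_mul]; norm_num, ← Finset.card_univ]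
    exact Finset.sum_le_card_nsmul _ _ _ fun e _ => Nat.pow_le_pow_right (by norm_num) (hsc e)
  have hn1 : 1 ≤ n := by
    obtain ⟨v, -⟩ := hrange (⟨0, hk⟩, ⟨0, hk⟩) ∅ (Finset.empty_subset _)
    exact Fin.pos v
  have hcard := fun b => card_restrictions hinj hrange b
  rw [hE] at hcard
  refine ⟨n, hn1, hn, consistencyGraph scope label, ?_, ?_⟩
  · have h := three_pow_le_xc hinj hscope hrange hpick
      {S | (consistencyGraph scope label).IsIndepSet (S : Set (Fin n)) ∧ S.card = k ^ 2}
      (fun S hS => hS.1) (fun b => ⟨isIndepSet_restrictions b, hcard b⟩)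
    rwa [hX] at h
  · have h := three_pow_le_xc hinj hscope hrange hpick
      {S | (consistencyGraph scope label).IsIndepSet (S : Set (Fin n)) ∧ S.card ≤ k ^ 2}
      (fun S hS => hS.1) (fun b => ⟨isIndepSet_restrictions b, (hcard b).le⟩)
    rwa [hX] at h

/-- A graph parameter as large as in `exists_graph_three_pow_le_xc` has no bound of the form
`f k * n ^ c`. -/
theorem not_exists_bound (p : ∀ (_k n : ℕ), SimpleGraph (Fin n) → ℕ)
    (hp : ∀ k t : ℕ, 1 ≤ k → ∃ n : ℕ, 1 ≤ n ∧ n ≤ k ^ 2 * 4 ^ t ∧ ∃ G : SimpleGraph (Fin n),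
      3 ^ (k * t) ≤ (p (k ^ 2) n G + 1) * 2 ^ (k * t)) :
    ¬ ∃ f : ℕ → ℝ, ∃ c : ℝ, ∀ (k n : ℕ), 1 ≤ n → ∀ G : SimpleGraph (Fin n),
      (p k n G : ℝ) ≤ f k * (n : ℝ) ^ c := by
  rintro ⟨f, c, hf⟩
  obtain ⟨C, hC⟩ := exists_nat_ge c
  -- `k` depends only on `c`: `4 ^ C` pays for the growth of `n ^ c` in `t`, and the factor `2`
  -- leaves `2 ^ t` to outgrow the constant `D`, which involves `f (k ^ 2)`.
  obtain ⟨k₀, hk₀⟩ := pow_unbounded_of_one_lt (2 * 4 ^ C : ℝ) (show (1 : ℝ) < 3 / 2 by norm_num)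
  set k := k₀ + 1 with hk
  have hk2 : (2 * 4 ^ C : ℝ) ≤ (3 / 2) ^ k :=
    hk₀.le.trans (pow_le_pow_right₀ (by norm_num) (Nat.le_succ k₀))
  set D : ℝ := |f (k ^ 2)| * ((k : ℝ) ^ 2) ^ C + 1 with hD
  obtain ⟨t, ht⟩ := pow_unbounded_of_one_lt D (show (1 : ℝ) < 2 by norm_num)
  obtain ⟨n, hn1, hn, G, hG⟩ := hp k t (by omega)
  have hn1' : (1 : ℝ) ≤ n := by exact_mod_cast hn1
  have hn' : (n : ℝ) ≤ (k : ℝ) ^ 2 * 4 ^ t := by exact_mod_cast hn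
  have hpow : (n : ℝ) ^ c ≤ ((k : ℝ) ^ 2 * 4 ^ t) ^ C := by
    calc (n : ℝ) ^ c ≤ (n : ℝ) ^ (C : ℝ) := Real.rpow_le_rpow_of_exponent_le hn1' hC
      _ = (n : ℝ) ^ C := Real.rpow_natCast _ _
      _ ≤ _ := pow_le_pow_left₀ (by positivity) hn' C
  have hbound : (p (k ^ 2) n G : ℝ) + 1 ≤ D * (4 ^ C) ^ t := by
    have h1 : f (k ^ 2) * (n : ℝ) ^ c ≤ |f (k ^ 2)| * ((k : ℝ) ^ 2 * 4 ^ t) ^ C :=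
      (mul_le_mul_of_nonneg_right (le_abs_self _) (by positivity)).trans
        (mul_le_mul_of_nonneg_left hpow (abs_nonneg _))
    have h2 : |f (k ^ 2)| * ((k : ℝ) ^ 2 * 4 ^ t) ^ C + (4 ^ C) ^ t = D * (4 ^ C) ^ t := by
      rw [hD, mul_pow, ← pow_mul 4 t C, ← pow_mul 4 C t, mul_comm t C]
      ring
    have h3 : (1 : ℝ) ≤ (4 ^ C) ^ t := one_le_pow₀ (one_le_pow₀ (by norm_num))
    linarith [hf (k ^ 2) n hn1 G]
  have hG' : ((3 : ℝ) / 2) ^ (k * t) ≤ p (k ^ 2) n G + 1 := by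
    rw [div_pow, div_le_iff₀ (by positivity)]
    exact_mod_cast hG
  have h4 : (2 : ℝ) ^ t * (4 ^ C) ^ t ≤ D * (4 ^ C) ^ t := by
    rw [← mul_pow]
    calc (2 * 4 ^ C : ℝ) ^ t ≤ ((3 / 2) ^ k) ^ t := pow_le_pow_left₀ (by positivity) hk2 t
      _ = (3 / 2) ^ (k * t) := (pow_mul _ _ _).symm
      _ ≤ _ := hG'.trans hbound
  exact absurd (le_of_mul_le_mul_right h4 (by positivity)) (not_le.2 ht)

end ExtensionComplexity

theorem theorem3p5 :
    (¬ ∃ f : ℕ → ℝ, ∃ c : ℝ, ∀ (k n : ℕ), 1 ≤ n → ∀ G : SimpleGraph (Fin n),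
      (ExtensionComplexity.xc (ExtensionComplexity.stab k G) : ℝ) ≤ f k * (n : ℝ) ^ c) ∧
    (¬ ∃ f : ℕ → ℝ, ∃ c : ℝ, ∀ (k n : ℕ), 1 ≤ n → ∀ G : SimpleGraph (Fin n),
      (ExtensionComplexity.xc (ExtensionComplexity.stabLE k G) : ℝ) ≤ f k * (n : ℝ) ^ c) := by
  refine ⟨ExtensionComplexity.not_exists_bound
      (fun k n G => ExtensionComplexity.xc (ExtensionComplexity.stab k G)) fun k t hk => ?_,
    ExtensionComplexity.not_exists_bound
      (fun k n G => ExtensionComplexity.xc (ExtensionComplexity.stabLE k G)) fun k t hk => ?_⟩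
  · obtain ⟨n, h1, h2, G, h3, _⟩ := ExtensionComplexity.exists_graph_three_pow_le_xc k t hk
    exact ⟨n, h1, h2, G, h3⟩
  · obtain ⟨n, h1, h2, G, _, h3⟩ := ExtensionComplexity.exists_graph_three_pow_le_xc k t hk
    exact ⟨n, h1, h2, G, h3⟩
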